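/- Let $G$ be a finite simple graph. A set $M\subseteq V(G)$ is a mutual-visibility set if for any two vertices $u,v\in M$ there is a shortest $u$-$v$ path in $G$ none of whose internal vertices lies in $M$. Let $\chi_\mu(G)$ be the least number of colors in a coloring of $V(G)$ such that every color class is a mutual-visibility set. For $n\in\mathbb{N}$, let $Q_n$ be the $n$-dimensional hypercube, that is, the graph whose vertices are the subsets of $\{1,\dots,n\}$, where two subsets $A,B$ are adjacent if and only if $|A\,\triangle\,B|=1$. Theorem. As $n\to\infty$, $\chi_\mu(Q_n)=\omega(1)$, that is, $\chi_\mu(Q_n)\to\infty$, and $\chi_\mu(Q_n)=O(\log_2\log_2 n)$, that is, there are constants $K$ and $n_0$ such that $\chi_\mu(Q_n)\le K\log_2\log_2 n$ for all $n\ge n_0$. In particular, there is no absolute constant $C>0$ such that $\chi_\mu(Q_n)\le C$ for all $n\in\mathbb{N}$. -/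

import Mathlib

/-- A set `M` of vertices of `G` is a mutual-visibility set if any two vertices `u, v ∈ M` are
joined by a shortest path of `G` none of whose internal vertices lies in `M`.
(For `u = v` the trivial path always works.) -/
def SimpleGraph.IsMutualVisibilitySet {V : Type*} (G : SimpleGraph V) (M : Set V) : Prop :=
  ∀ u ∈ M, ∀ v ∈ M, ∃ p : G.Walk u v, p.IsPath ∧ p.length = G.dist u v ∧
    ∀ w ∈ p.support, w ≠ u → w ≠ v → w ∉ M

/-- The vertices of `G` can be coloured with `q` colours so that each colour class is a
mutual-visibility set. -/
def SimpleGraph.MutualVisibilityColorable {V : Type*} (G : SimpleGraph V) (q : ℕ) : Prop :=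
  ∃ c : V → Fin q, ∀ i : Fin q, G.IsMutualVisibilitySet {v | c v = i}

/-- The mutual-visibility chromatic number of a finite graph `G`: the least number of colours in a
colouring of the vertices all of whose colour classes are mutual-visibility sets. -/
noncomputable def SimpleGraph.mutualVisibilityChromaticNumber {V : Type*} [Finite V]
    (G : SimpleGraph V) : ℕ :=
  sInf {q : ℕ | G.MutualVisibilityColorable q}

/-- On a finite graph some number of colours suffices, so the infimum above is a minimum. -/
theorem SimpleGraph.mutualVisibilityColorable_chromaticNumber {V : Type*} [Finite V]
    (G : SimpleGraph V) :
    G.MutualVisibilityColorable G.mutualVisibilityChromaticNumber := by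
  refine Nat.sInf_mem (s := {q : ℕ | G.MutualVisibilityColorable q})
    ⟨Nat.card V, Finite.equivFin V, fun i u hu v hv => ?_⟩
  obtain rfl : u = v := (Finite.equivFin V).injective (hu.trans hv.symm)
  exact ⟨.nil, by simp, by simp, by simp⟩

/-- The `n`-dimensional hypercube: the vertices are the subsets of an `n`-element set, and two of
them are adjacent if and only if their symmetric difference has exactly one element. -/
def hypercube (n : ℕ) : SimpleGraph (Finset (Fin n)) where
  Adj A B := (symmDiff A B).card = 1
  symm := ⟨fun A B h => by rwa [symmDiff_comm]⟩
  loopless := ⟨fun A h => by simp at h⟩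

/-! The distance in the hypercube is the size of the symmetric difference, and the vertices on
shortest `A`-`B` paths are those of the lattice interval `Set.uIcc A B`.

Lower bound: by Ramsey's theorem, for large `n` the colour of every small subset of some large set
depends on its size only. Among the sizes up to `2 * q` three share a colour; two nested sets of
the extreme sizes then do not see each other, since every path between them meets the middle layer.

Upper bound: a set of vertices living in layers congruent modulo `t ≥ 3` is a mutual-visibility set
as soon as it contains no daisy, that is, no family `S ∪ P` with `P` running over the `t`-subsets of
a `2 * t`-set disjoint from `S`: a shortest path can move freely between two consecutive layers of
the class, and crosses a layer through a gap provided by daisy-freeness. To split the cube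
into two daisy-free families, send `X` to its first `2 * t` power sums over a finite field with at
least `n` elements. This turns daisies into translates `k + {powerSums P}` with `C(2t, t)` elements,
of which there are at most `2 ^ (4 t log n)`, so a random two-colouring of the power sums works
once `C(2t, t)` exceeds `4 t log n`, which happens for some `t = O(log log n)`. -/

open Finset

universe u

section MutuallyVisible

variable {V : Type*} {G : SimpleGraph V} {M : Set V} {u v w : V}

/-- `M`-visibility of two vertices: they are joined by a shortest walk with no internal vertex in
`M`. Only walks are asked for, a walk of length `G.dist u v` being automatically a path. -/
def MutuallyVisible (G : SimpleGraph V) (M : Set V) (u v : V) : Prop :=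
  ∃ p : G.Walk u v, p.length = G.dist u v ∧ ∀ w ∈ p.support, w ≠ u → w ≠ v → w ∉ M

lemma isMutualVisibilitySet_iff :
    G.IsMutualVisibilitySet M ↔ ∀ u ∈ M, ∀ v ∈ M, MutuallyVisible G M u v :=
  forall₄_congr fun _ _ _ _ => exists_congr fun p =>
    ⟨fun h => h.2, fun h => ⟨p.isPath_of_length_eq_dist h.1, h⟩⟩

lemma MutuallyVisible.refl (u : V) : MutuallyVisible G M u u :=
  ⟨.nil, by simp, by simp⟩

lemma MutuallyVisible.symm (h : MutuallyVisible G M u v) : MutuallyVisible G M v u := by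
  obtain ⟨p, hp, hpM⟩ := h
  refine ⟨p.reverse, by rw [p.length_reverse, hp, G.dist_comm], fun w hw hv hu => ?_⟩
  exact hpM w (by simpa using hw) hu hv

lemma MutuallyVisible.trans (huv : MutuallyVisible G M u v) (hvw : MutuallyVisible G M v w)
    (hv : v ∉ M) (hd : G.dist u v + G.dist v w = G.dist u w) : MutuallyVisible G M u w := by
  obtain ⟨p, hp, hpM⟩ := huv
  obtain ⟨q, hq, hqM⟩ := hvw
  refine ⟨p.append q, by rw [p.length_append, hp, hq, hd], fun x hx hxu hxw => ?_⟩
  rcases eq_or_ne x v with rfl | hxv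
  · exact hv
  · rcases (SimpleGraph.Walk.mem_support_append_iff p q).mp hx with hx | hx
    exacts [hpM x hx hxu hxv, hqM x hx hxv hxw]

lemma mutuallyVisible_of_adj (h : G.Adj u v) : MutuallyVisible G M u v := by
  refine ⟨h.toWalk, by simp [SimpleGraph.dist_eq_one_iff_adj.mpr h], fun w hw hu hv => ?_⟩
  simp_all

lemma dist_add_dist_of_mem_support (p : G.Walk u v) (hp : p.length = G.dist u v)
    (hw : w ∈ p.support) : G.dist u w + G.dist w v = G.dist u v := by
  obtain ⟨q, r, rfl⟩ := SimpleGraph.Walk.mem_support_iff_exists_append.mp hw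
  refine le_antisymm ?_ (q.reachable.dist_triangle_left v)
  rw [← hp, SimpleGraph.Walk.length_append]
  exact add_le_add (SimpleGraph.dist_le q) (SimpleGraph.dist_le r)

lemma mutualVisibilityChromaticNumber_le_card [Finite V] {κ : Type*} [Fintype κ] (c : V → κ)
    (hc : ∀ i, G.IsMutualVisibilitySet {v | c v = i}) :
    G.mutualVisibilityChromaticNumber ≤ Fintype.card κ := by
  refine Nat.sInf_le ⟨Fintype.equivFin κ ∘ c, fun i => ?_⟩
  simpa only [Function.comp_apply, ← Equiv.eq_symm_apply] using hc ((Fintype.equivFin κ).symm i)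

end MutuallyVisible

section HypercubeDist

lemma mem_uIcc_iff_subset {α : Type*} [DecidableEq α] {A B Y : Finset α} :
    Y ∈ Set.uIcc A B ↔ A ∩ B ⊆ Y ∧ Y ⊆ A ∪ B :=
  Iff.rfl

lemma card_symmDiff_add_card_symmDiff_eq_iff {α : Type*} [DecidableEq α] {A B Y : Finset α} :
    #(symmDiff A Y) + #(symmDiff Y B) = #(symmDiff A B) ↔ Y ∈ Set.uIcc A B := by
  have hcard : #(symmDiff A Y) + #(symmDiff Y B) =
      #(symmDiff A B) + 2 * #(symmDiff A Y ∩ symmDiff Y B) := by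
    have hAB : symmDiff A B = (symmDiff A Y ∪ symmDiff Y B) \ (symmDiff A Y ∩ symmDiff Y B) := by
      grind [Finset.mem_symmDiff]
    have hle : symmDiff A Y ∩ symmDiff Y B ⊆ symmDiff A Y ∪ symmDiff Y B := by grind
    have hsdiff := card_sdiff_add_card_eq_card hle
    rw [← hAB] at hsdiff
    have := card_union_add_card_inter (symmDiff A Y) (symmDiff Y B)
    omega
  have hinter : symmDiff A Y ∩ symmDiff Y B = ∅ ↔ Y ∈ Set.uIcc A B := by
    simp only [mem_uIcc_iff_subset, eq_empty_iff_forall_notMem, subset_iff, mem_inter, mem_union,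
      Finset.mem_symmDiff]
    grind
  rw [← hinter, ← card_eq_zero]
  omega

variable {n : ℕ} {A B Y : Finset (Fin n)} {M : Set (Finset (Fin n))}

lemma hypercube_adj_insert {y : Fin n} (hy : y ∉ A) : (hypercube n).Adj A (insert y A) :=
  card_eq_one.mpr ⟨y, by grind [Finset.mem_symmDiff]⟩

lemma hypercube_adj_erase {x : Fin n} (hx : x ∈ A) : (hypercube n).Adj A (A.erase x) :=
  card_eq_one.mpr ⟨x, by grind [Finset.mem_symmDiff]⟩

lemma card_le_card_add_one_of_hypercube_adj (h : (hypercube n).Adj A B) : #B ≤ #A + 1 := by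
  have hdiff : #(B \ A) ≤ #(symmDiff A B) := card_le_card subset_union_right
  have hAB : #(symmDiff A B) = 1 := h
  have := le_card_sdiff A B
  omega

lemma exists_hypercube_adj_mem_uIcc {lo hi : ℕ} (hlh : lo < hi) (hA : #A ∈ Set.Icc lo hi)
    (hB : #B ∈ Set.Icc lo hi) (hne : A ≠ B) :
    ∃ C, (hypercube n).Adj A C ∧ C ∈ Set.uIcc A B ∧ #C ∈ Set.Icc lo hi := by
  simp only [mem_uIcc_iff_subset, Set.mem_Icc] at *
  by_cases hdown : lo < #A ∧ ¬ A ⊆ B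
  · obtain ⟨x, hxA, hxB⟩ := not_subset.mp hdown.2
    have := card_erase_of_mem hxA
    exact ⟨A.erase x, hypercube_adj_erase hxA, by grind, by omega⟩
  · have hBA : ¬ B ⊆ A := fun h => by
      have : ¬ A ⊆ B := fun h' => hne (h'.antisymm h)
      exact hne (eq_of_subset_of_card_le h (by grind)).symm
    have hlt : #A < hi := by
      by_contra! hge
      have hAB : A ⊆ B := by grind
      exact hne (eq_of_subset_of_card_le hAB (by omega))
    obtain ⟨y, hyB, hyA⟩ := not_subset.mp hBA
    have := card_insert_of_notMem hyA
    exact ⟨insert y A, hypercube_adj_insert hyA, by grind, by omega⟩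

lemma exists_walk_card_mem_Icc {lo hi : ℕ} (hlh : lo < hi) (hA : #A ∈ Set.Icc lo hi)
    (hB : #B ∈ Set.Icc lo hi) :
    ∃ p : (hypercube n).Walk A B, p.length = #(symmDiff A B) ∧
      ∀ W ∈ p.support, #W ∈ Set.Icc lo hi := by
  induction hd : #(symmDiff A B) generalizing A with
  | zero =>
    obtain rfl : A = B := by simpa using hd
    exact ⟨.nil, by simp, by simpa using hA⟩
  | succ d ih =>
    obtain ⟨C, hAC, hCAB, hC⟩ :=
      exists_hypercube_adj_mem_uIcc hlh hA hB (by rintro rfl; simp at hd)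
    have hCB : #(symmDiff A C) + #(symmDiff C B) = #(symmDiff A B) :=
      card_symmDiff_add_card_symmDiff_eq_iff.mpr hCAB
    have hone : #(symmDiff A C) = 1 := hAC
    obtain ⟨p, hp, hpcard⟩ := ih hC (by omega)
    exact ⟨.cons hAC p, by simp [hp], by simpa using ⟨hA, hpcard⟩⟩

lemma card_symmDiff_le_length (p : (hypercube n).Walk A B) : #(symmDiff A B) ≤ p.length := by
  induction p with
  | nil => simp
  | @cons A C B h p ih =>
    calc #(symmDiff A B) ≤ #(symmDiff A C ∪ symmDiff C B) := card_le_card (symmDiff_triangle A C B)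
      _ ≤ #(symmDiff A C) + #(symmDiff C B) := card_union_le _ _
      _ ≤ 1 + p.length := add_le_add (le_of_eq h) ih
      _ = (p.cons h).length := by rw [SimpleGraph.Walk.length_cons, add_comm]

lemma hypercube_dist (A B : Finset (Fin n)) : (hypercube n).dist A B = #(symmDiff A B) := by
  have hcard : ∀ C : Finset (Fin n), #C ∈ Set.Icc 0 (n + 1) := fun C =>
    ⟨Nat.zero_le _, (card_finset_fin_le C).trans n.le_succ⟩
  obtain ⟨p, hp, -⟩ := exists_walk_card_mem_Icc n.succ_pos (hcard A) (hcard B)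
  obtain ⟨q, hq⟩ := p.reachable.exists_walk_length_eq_dist
  exact le_antisymm (hp ▸ SimpleGraph.dist_le p) (hq ▸ card_symmDiff_le_length q)

lemma hypercube_dist_add_dist_eq_iff :
    (hypercube n).dist A Y + (hypercube n).dist Y B = (hypercube n).dist A B ↔
      Y ∈ Set.uIcc A B := by
  simp only [hypercube_dist, card_symmDiff_add_card_symmDiff_eq_iff]

lemma exists_mem_support_card_eq (p : (hypercube n).Walk A B) {j : ℕ} (hA : #A ≤ j)
    (hB : j < #B) : ∃ W ∈ p.support, #W = j := by
  obtain ⟨d, hd, hfst, hsnd⟩ := p.exists_boundary_dart {W | #W ≤ j} hA (by simpa using hB)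
  have hstep := card_le_card_add_one_of_hypercube_adj d.adj
  simp only [Set.mem_ofPred_eq, not_le] at hfst hsnd
  exact ⟨d.fst, p.dart_fst_mem_support_of_mem_darts hd, by omega⟩

lemma mutuallyVisible_of_card_mem_Icc {lo hi : ℕ} (hlh : lo < hi) (hA : #A ∈ Set.Icc lo hi)
    (hB : #B ∈ Set.Icc lo hi) (hM : ∀ W ∈ M, #W ∉ Set.Icc lo hi) :
    MutuallyVisible (hypercube n) M A B := by
  obtain ⟨p, hp, hpcard⟩ := exists_walk_card_mem_Icc hlh hA hB
  exact ⟨p, by rw [hp, hypercube_dist], fun W hW _ _ hWM => hM W hWM (hpcard W hW)⟩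

end HypercubeDist

section Ramsey

lemma forall_subset_insert_eq_of_link {α κ : Type*} [DecidableEq α] {c : Finset α → κ}
    {T : Finset α} {a : α} {r : ℕ} {i : κ} (hhom : ∀ X ⊆ T, #X = r + 1 → c X = i)
    (hlink : ∀ X ⊆ T, #X = r → c (insert a X) = i) :
    ∀ X ⊆ insert a T, #X = r + 1 → c X = i := by
  intro X hX hXr
  by_cases haX : a ∈ X
  · rw [← insert_erase haX]
    refine hlink _ (subset_insert_iff.mp hX) ?_
    rw [card_erase_of_mem haX, hXr, Nat.add_sub_cancel]
  · exact hhom X ((subset_insert_iff_of_notMem haX).mp hX) hXr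

/- Induction on `r`, then on `∑ i, k i`: if the link of a vertex `a` in a large set `S'` is
monochromatic of colour `i`, look in `S'` for homogeneous sets with `k i` lowered by one, as one of
colour `i` can be extended by `a`. -/
theorem exists_homogeneous_subset {κ : Type*} [Finite κ] (r : ℕ) (k : κ → ℕ) :
    ∃ N : ℕ, ∀ {α : Type u} (c : Finset α → κ) (S : Finset α), N ≤ #S →
      ∃ i, ∃ T ⊆ S, k i ≤ #T ∧ ∀ X ⊆ T, #X = r → c X = i := by
  classical
  cases nonempty_fintype κ
  induction r generalizing k with
  | zero =>
    refine ⟨∑ i, k i, fun c S hS => ⟨c ∅, S, subset_rfl, ?_, fun X _ hX => ?_⟩⟩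
    · exact (single_le_sum (fun i _ => Nat.zero_le (k i)) (mem_univ _)).trans hS
    · rw [card_eq_zero.mp hX]
  | succ r ihr =>
    induction hs : ∑ i, k i using Nat.strong_induction_on generalizing k with
    | _ s ihs =>
    subst hs
    by_cases hzero : ∃ i, k i = 0
    · obtain ⟨i, hi⟩ := hzero
      refine ⟨0, fun c S _ => ⟨i, ∅, empty_subset S, by simp [hi], fun X hX hXr => ?_⟩⟩
      simp [subset_empty.mp hX] at hXr
    push Not at hzero
    have hlower : ∀ i, ∑ j, Function.update k i (k i - 1) j < ∑ j, k j := fun i =>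
      sum_lt_sum (fun j _ => by rcases eq_or_ne j i with rfl | h <;> simp [*])
        ⟨i, mem_univ i, by simpa using Nat.pos_of_ne_zero (hzero i)⟩
    choose N hN using fun i => ihs _ (hlower i) _ rfl
    obtain ⟨N', hN'⟩ := ihr fun _ => ∑ i, N i
    refine ⟨N' + 1, fun {α} c S hS => ?_⟩
    obtain ⟨a, ha⟩ : S.Nonempty := card_pos.mp (by omega)
    obtain ⟨i, S', hS', hS'card, hlink⟩ := hN' (fun X => c (insert a X)) (S.erase a)
      (by rw [card_erase_of_mem ha]; omega)
    have hNi : N i ≤ #S' :=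
      (single_le_sum (fun j _ => Nat.zero_le (N j)) (mem_univ i)).trans hS'card
    obtain ⟨j, T, hTS', hT, hhom⟩ := hN i c S' hNi
    have hTS : T ⊆ S.erase a := hTS'.trans hS'
    rcases eq_or_ne j i with rfl | hji
    · have haT : a ∉ T := fun h => notMem_erase a S (hTS h)
      refine ⟨j, insert a T, insert_subset ha (hTS.trans (erase_subset a S)), ?_,
        forall_subset_insert_eq_of_link hhom fun X hX => hlink X (hX.trans hTS')⟩
      rw [Function.update_self] at hT
      rw [card_insert_of_notMem haT]
      omega
    · rw [Function.update_of_ne hji] at hT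
      exact ⟨j, T, hTS.trans (erase_subset a S), hT, hhom⟩

theorem exists_forall_eq_of_card_lt (κ : Type*) [Finite κ] (k m : ℕ) :
    ∃ N : ℕ, ∀ {α : Type u} (c : Finset α → κ) (S : Finset α), N ≤ #S →
      ∃ T ⊆ S, m ≤ #T ∧ ∃ f : ℕ → κ, ∀ X ⊆ T, #X < k → c X = f #X := by
  induction k generalizing m with
  | zero => exact ⟨m, fun c S hS => ⟨S, subset_rfl, hS, fun _ => c ∅, by simp⟩⟩
  | succ k ih =>
    obtain ⟨N, hN⟩ := exists_homogeneous_subset k fun _ : κ => m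
    obtain ⟨N', hN'⟩ := ih N
    refine ⟨N', fun c S hS => ?_⟩
    obtain ⟨S', hS'S, hS', f, hf⟩ := hN' c S hS
    obtain ⟨i, T, hTS', hT, hi⟩ := hN c S' hS'
    refine ⟨T, hTS'.trans hS'S, hT, Function.update f k i, fun X hX hXk => ?_⟩
    rcases Nat.lt_succ_iff_lt_or_eq.mp hXk with h | h
    · rw [Function.update_of_ne h.ne, hf X (hX.trans hTS') h]
    · rw [h, Function.update_self, hi X hX h]

end Ramsey

section LowerBound

lemma exists_lt_lt_le_two_mul_card {κ : Type*} [Fintype κ] (f : ℕ → κ) :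
    ∃ i j l, i < j ∧ j < l ∧ l ≤ 2 * Fintype.card κ ∧ f i = f l ∧ f j = f l := by
  classical
  obtain ⟨a, -, ha⟩ := exists_lt_card_fiber_of_mul_lt_card_of_maps_to
    (s := range (2 * Fintype.card κ + 1)) (t := univ) (f := f) (n := 2)
    (fun i _ => mem_univ (f i)) (by rw [card_range, card_univ]; omega)
  let e := orderEmbOfCardLe _ (Nat.succ_le_of_lt ha)
  have he (x : Fin 3) : e x < 2 * Fintype.card κ + 1 ∧ f (e x) = a := by
    simpa only [mem_filter, mem_range] using orderEmbOfCardLe_mem _ (Nat.succ_le_of_lt ha) x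
  exact ⟨e 0, e 1, e 2, e.strictMono (by decide), e.strictMono (by decide),
    Nat.le_of_lt_succ (he 2).1, (he 0).2.trans (he 2).2.symm, (he 1).2.trans (he 2).2.symm⟩

lemma not_isMutualVisibilitySet_of_layer_subset {n j : ℕ} {A B : Finset (Fin n)}
    {M : Set (Finset (Fin n))} (hA : A ∈ M) (hB : B ∈ M) (hAB : A ⊆ B) (hAj : #A < j)
    (hjB : j < #B) (hM : ∀ W ∈ Set.Icc A B, #W = j → W ∈ M) :
    ¬ (hypercube n).IsMutualVisibilitySet M := by
  intro hvis
  obtain ⟨p, hp, hpM⟩ := isMutualVisibilitySet_iff.mp hvis A hA B hB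
  obtain ⟨W, hWp, hWj⟩ := exists_mem_support_card_eq p hAj.le hjB
  have hW : W ∈ Set.Icc A B := Set.uIcc_of_le hAB ▸
    hypercube_dist_add_dist_eq_iff.mp (dist_add_dist_of_mem_support p hp hWp)
  exact hpM W hWp (by rintro rfl; omega) (by rintro rfl; omega) (hM W hW hWj)

theorem eventually_not_mutualVisibilityColorable_hypercube (q : ℕ) :
    ∀ᶠ n in Filter.atTop, ¬ (hypercube n).MutualVisibilityColorable q := by
  obtain ⟨N, hN⟩ := exists_forall_eq_of_card_lt (Fin q) (2 * q + 1) (2 * q)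
  filter_upwards [Filter.eventually_ge_atTop N] with n hn
  rintro ⟨c, hc⟩
  obtain ⟨T, -, hT, f, hf⟩ := hN c univ (by simpa using hn)
  obtain ⟨i, j, l, hij, hjl, hl, hfi, hfj⟩ := exists_lt_lt_le_two_mul_card f
  rw [Fintype.card_fin] at hl
  obtain ⟨B, hBT, hB⟩ := exists_subset_card_eq (hl.trans hT)
  obtain ⟨A, hAB, hA⟩ := exists_subset_card_eq (hB ▸ (hij.trans hjl).le)
  have hcol : ∀ X ⊆ B, f #X = f l → c X = f l := fun X hXB hX =>
    (hf X (hXB.trans hBT) (by have := card_le_card hXB; omega)).trans hX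
  refine not_isMutualVisibilitySet_of_layer_subset (j := j) (hcol A hAB (hA ▸ hfi))
    (hcol B subset_rfl (hB ▸ rfl)) hAB (hA ▸ hij) (hB ▸ hjl) (fun W hW hWj => ?_) (hc (f l))
  exact hcol W hW.2 (hWj ▸ hfj)

theorem tendsto_mutualVisibilityChromaticNumber_hypercube :
    Filter.Tendsto (fun n : ℕ => (hypercube n).mutualVisibilityChromaticNumber)
      Filter.atTop Filter.atTop := by
  refine Filter.tendsto_atTop.mpr fun q => ?_
  have hsmall := (Filter.eventually_all_finite (Set.finite_lt_nat q)).mpr fun q' _ =>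
    eventually_not_mutualVisibilityColorable_hypercube q'
  filter_upwards [hsmall] with n hn
  by_contra! hlt
  exact hn _ hlt (hypercube n).mutualVisibilityColorable_chromaticNumber

end LowerBound

section Daisies

variable {α : Type*} [DecidableEq α]

/-- The daisy with stem `S` and ground set `T`: the sets `S ∪ P` with `P` a `t`-element subset
of `T`. -/
def daisy (S T : Finset α) (t : ℕ) : Finset (Finset α) :=
  (T.powersetCard t).image (S ∪ ·)

/-- A family of finite sets is daisy-free (with parameter `t`) if it contains no daisy whose petals
are the `t`-subsets of a `2 * t`-element set disjoint from the stem. -/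
def IsDaisyFree (t : ℕ) (M : Set (Finset α)) : Prop :=
  ∀ S T : Finset α, Disjoint S T → #T = 2 * t → ¬ (daisy S T t : Set (Finset α)) ⊆ M

lemma IsDaisyFree.mono {t : ℕ} {M M' : Set (Finset α)} (h : IsDaisyFree t M') (hM : M ⊆ M') :
    IsDaisyFree t M :=
  fun S T hST hT hsub => h S T hST hT (hsub.trans hM)

lemma IsDaisyFree.exists_notMem_mem_uIcc {t : ℕ} {M : Set (Finset α)} (hM : IsDaisyFree t M)
    {A B : Finset α} (hAB : #A + 2 * t ≤ #B) : ∃ X ∉ M, X ∈ Set.uIcc A B ∧ #X = #A + t := by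
  obtain ⟨S, hS, hSB, hScard⟩ := exists_subsuperset_card_eq (inter_subset_right (s₁ := A) (s₂ := B))
    (card_le_card inter_subset_left) (by omega)
  obtain ⟨T, hT, hTcard⟩ := exists_subset_card_eq
    (s := B \ S) (n := 2 * t) (by rw [card_sdiff_of_subset hSB]; omega)
  have hST : Disjoint S T := disjoint_of_subset_right hT disjoint_sdiff
  obtain ⟨X, hX, hXM⟩ := Set.not_subset.mp (hM S T hST hTcard)
  obtain ⟨P, hP, rfl⟩ := mem_image.mp (mem_coe.mp hX)
  obtain ⟨hPT, hPcard⟩ := mem_powersetCard.mp hP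
  refine ⟨S ∪ P, hXM, ⟨hS.trans subset_union_left, ?_⟩, ?_⟩
  · exact (union_subset hSB (hPT.trans (hT.trans sdiff_subset))).trans subset_union_right
  · rw [card_union_of_disjoint (disjoint_of_subset_right hPT hST), hScard, hPcard]

end Daisies

section Visibility

variable {n : ℕ} {A B C D : Finset (Fin n)} {M : Set (Finset (Fin n))}

lemma mutuallyVisible_of_corridor {lo hi : ℕ} (hlh : lo < hi) (hAC : (hypercube n).Adj A C)
    (hDB : (hypercube n).Adj D B) (hC : #C ∈ Set.Icc lo hi) (hD : #D ∈ Set.Icc lo hi)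
    (hCAB : C ∈ Set.uIcc A B) (hDCB : D ∈ Set.uIcc C B) (hM : ∀ W ∈ M, #W ∉ Set.Icc lo hi) :
    MutuallyVisible (hypercube n) M A B := by
  have hCB : MutuallyVisible (hypercube n) M C B :=
    (mutuallyVisible_of_card_mem_Icc hlh hC hD hM).trans (mutuallyVisible_of_adj hDB)
      (fun h => hM D h hD) (hypercube_dist_add_dist_eq_iff.mpr hDCB)
  exact (mutuallyVisible_of_adj hAC).trans hCB (fun h => hM C h hC)
    (hypercube_dist_add_dist_eq_iff.mpr hCAB)

lemma mutuallyVisible_of_card_add_three_le (hAB : #A + 3 ≤ #B)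
    (hM : ∀ W ∈ M, #W ∉ Set.Ioo #A #B) : MutuallyVisible (hypercube n) M A B := by
  obtain ⟨y, hy, z, hz, hyz⟩ := one_lt_card.mp
    (show 1 < #(B \ A) by have := le_card_sdiff A B; omega)
  rw [mem_sdiff] at hy hz
  have hC := card_insert_of_notMem hy.2
  have hD := card_erase_of_mem hz.1
  refine mutuallyVisible_of_corridor (lo := #A + 1) (hi := #B - 1) (by omega)
    (hypercube_adj_insert hy.2) (hypercube_adj_erase hz.1).symm ⟨by omega, by omega⟩
    ⟨by omega, by omega⟩ ?_ ?_ fun W hW hWcard => hM W hW ⟨?_, ?_⟩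
  · rw [mem_uIcc_iff_subset]; grind
  · rw [mem_uIcc_iff_subset]; grind
  · exact hWcard.1
  · have := hWcard.2; omega

lemma mutuallyVisible_of_card_eq (hAB : #A = #B) (hM : ∀ W ∈ M, #W ∉ Set.Ioo #A (#A + 3)) :
    MutuallyVisible (hypercube n) M A B := by
  rcases eq_or_ne A B with rfl | hne
  · exact .refl A
  obtain ⟨x, hxA, hxB⟩ := not_subset.mp fun h => hne (eq_of_subset_of_card_le h hAB.ge)
  obtain ⟨y, hyB, hyA⟩ := not_subset.mp fun h => hne (eq_of_subset_of_card_le h hAB.le).symm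
  have hC := card_insert_of_notMem hyA
  have hD := card_insert_of_notMem hxB
  refine mutuallyVisible_of_corridor (lo := #A + 1) (hi := #A + 2) (by omega)
    (hypercube_adj_insert hyA) (hypercube_adj_insert hxB).symm ⟨by omega, by omega⟩
    ⟨by omega, by omega⟩ ?_ ?_ fun W hW hWcard => hM W hW ⟨?_, ?_⟩
  · rw [mem_uIcc_iff_subset]; grind
  · rw [mem_uIcc_iff_subset]; grind
  · exact hWcard.1
  · have := hWcard.2; omega

lemma notMem_Ioo_add_of_modEq {a b t : ℕ} (h : b ≡ a [MOD t]) : b ∉ Set.Ioo a (a + t) := by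
  rintro ⟨hab, hbt⟩
  have := Nat.le_of_dvd (by omega) ((Nat.modEq_iff_dvd' hab.le).mp h.symm)
  omega

variable {t r : ℕ}

lemma mutuallyVisible_of_card_eq_add_mul (ht : 3 ≤ t) (hM : ∀ W ∈ M, #W ≡ r [MOD t])
    (hfree : IsDaisyFree t M) (hA : #A ≡ r [MOD t]) {k : ℕ} (hAB : #B = #A + k * t) :
    MutuallyVisible (hypercube n) M A B := by
  have hgap {A : Finset (Fin n)} (hA : #A ≡ r [MOD t]) : ∀ W ∈ M, #W ∉ Set.Ioo #A (#A + t) :=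
    fun W hW => notMem_Ioo_add_of_modEq ((hM W hW).trans hA.symm)
  induction k generalizing A with
  | zero =>
    refine mutuallyVisible_of_card_eq (by omega) fun W hW hWcard => hgap hA W hW ?_
    exact Set.Ioo_subset_Ioo_right (by omega) hWcard
  | succ k ih =>
    rw [Nat.succ_mul] at hAB
    rcases Nat.eq_zero_or_pos k with rfl | hk
    · rw [zero_mul, zero_add] at hAB
      exact mutuallyVisible_of_card_add_three_le (by omega) (hAB ▸ hgap hA)
    obtain ⟨X, hXM, hXAB, hX⟩ := hfree.exists_notMem_mem_uIcc (A := A) (B := B)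
      (by have := Nat.le_mul_of_pos_left t hk; omega)
    have hAX : MutuallyVisible (hypercube n) M A X :=
      mutuallyVisible_of_card_add_three_le (by omega) (hX ▸ hgap hA)
    have hXB : MutuallyVisible (hypercube n) M X B :=
      ih (by rw [hX]; exact Nat.add_modEq_right.trans hA) (by omega)
    exact hAX.trans hXB hXM (hypercube_dist_add_dist_eq_iff.mpr hXAB)

theorem IsDaisyFree.isMutualVisibilitySet (hfree : IsDaisyFree t M) (ht : 3 ≤ t)
    (hM : ∀ W ∈ M, #W ≡ r [MOD t]) : (hypercube n).IsMutualVisibilitySet M := by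
  have hle {A B : Finset (Fin n)} (hA : A ∈ M) (hB : B ∈ M) (h : #A ≤ #B) :
      MutuallyVisible (hypercube n) M A B := by
    obtain ⟨k, hk⟩ := (Nat.modEq_iff_dvd' h).mp ((hM A hA).trans (hM B hB).symm)
    exact mutuallyVisible_of_card_eq_add_mul ht hM hfree (hM A hA) (k := k)
      (by rw [mul_comm]; omega)
  refine isMutualVisibilitySet_iff.mpr fun A hA B hB => ?_
  rcases le_total #A #B with h | h
  exacts [hle hA hB h, (hle hB hA h).symm]

end Visibility

section PropertyB

variable {V κ : Type*} [Fintype κ]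

lemma card_filter_forall_mem_eq [Fintype V] [DecidableEq V] (e : Finset V) (b : κ)
    [DecidablePred fun g : V → κ => ∀ x ∈ e, g x = b] :
    #{g : V → κ | ∀ x ∈ e, g x = b} = Fintype.card κ ^ (Fintype.card V - #e) := by
  have hpi : ({g : V → κ | ∀ x ∈ e, g x = b} : Finset (V → κ)) =
      Fintype.piFinset fun x => if x ∈ e then {b} else univ := by
    ext g
    simp only [mem_filter, mem_univ, true_and, Fintype.mem_piFinset]
    exact forall_congr' fun x => by by_cases hx : x ∈ e <;> simp [hx]
  rw [hpi, Fintype.card_piFinset, ← card_compl]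
  simp [apply_ite Finset.card, prod_ite, filter_not, compl_eq_univ_sdiff]

lemma exists_coloring_forall_exists_ne [Finite V] [Nonempty κ] (H : Finset (Finset V)) {N : ℕ}
    (hN : ∀ e ∈ H, N ≤ #e) (hH : #H * Fintype.card κ < Fintype.card κ ^ N) :
    ∃ g : V → κ, ∀ e ∈ H, ∀ b, ∃ x ∈ e, g x ≠ b := by
  classical
  cases nonempty_fintype V
  rcases H.eq_empty_or_nonempty with rfl | ⟨e₀, he₀⟩
  · exact ⟨fun _ => Classical.arbitrary κ, by simp⟩
  have hNV : N ≤ Fintype.card V := (hN e₀ he₀).trans (card_le_univ e₀)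
  let bad : Finset (V → κ) :=
    (H ×ˢ univ).biUnion fun eb : Finset V × κ => {g | ∀ x ∈ eb.1, g x = eb.2}
  have hbad : #bad < #(univ : Finset (V → κ)) :=
    calc #bad ≤ #(H ×ˢ (univ : Finset κ)) * Fintype.card κ ^ (Fintype.card V - N) := by
          refine card_biUnion_le_card_mul _ _ _ fun eb heb => ?_
          rw [card_filter_forall_mem_eq]
          exact Nat.pow_le_pow_right Fintype.card_pos
            (Nat.sub_le_sub_left (hN _ (mem_product.mp heb).1) _)
      _ < Fintype.card κ ^ N * Fintype.card κ ^ (Fintype.card V - N) := by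
          rw [card_product, card_univ]
          exact Nat.mul_lt_mul_of_pos_right hH (pow_pos Fintype.card_pos _)
      _ = #(univ : Finset (V → κ)) := by
          rw [← pow_add, Nat.add_sub_cancel' hNV, card_univ, Fintype.card_fun]
  obtain ⟨g, -, hg⟩ := exists_mem_notMem_of_card_lt_card hbad
  refine ⟨g, fun e he b => ?_⟩
  by_contra! hmono
  exact hg (mem_biUnion.mpr ⟨(e, b), by simp [he], by simpa using hmono⟩)

end PropertyB

section PowerSums

variable {α R : Type*} [CommRing R] {v : α → R} {d : ℕ}

/-- The first `d` power sums, with exponents `0, …, d - 1`, of the points `v x` for `x ∈ X`. -/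
def powerSums (v : α → R) (d : ℕ) (X : Finset α) : Fin d → R :=
  fun j => ∑ x ∈ X, v x ^ (j : ℕ)

variable [DecidableEq α]

lemma powerSums_union {S T : Finset α} (h : Disjoint S T) :
    powerSums v d (S ∪ T) = powerSums v d S + powerSums v d T :=
  funext fun _ => sum_union h

/-- A Vandermonde argument: the difference of the indicators of `S` and `T` is orthogonal to the
powers of `v`. -/
lemma eq_of_powerSums_eq [IsDomain R] (hv : Function.Injective v) {S T : Finset α}
    (hd : #(S ∪ T) ≤ d) (h : powerSums v d S = powerSums v d T) : S = T := by
  let e : Fin #(S ∪ T) ≃ (S ∪ T : Finset α) := (S ∪ T).equivFin.symm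
  let w : α → R := fun x => (if x ∈ S then 1 else 0) - if x ∈ T then 1 else 0
  have hsum (j : Fin #(S ∪ T)) : ∑ i, w (e i) * v (e i) ^ (j : ℕ) = 0 := by
    rw [e.sum_comp fun x : (S ∪ T : Finset α) => w x * v x ^ (j : ℕ),
      sum_coe_sort (S ∪ T) fun x => w x * v x ^ (j : ℕ)]
    simp only [w, sub_mul, ite_mul, one_mul, zero_mul, sum_sub_distrib, sum_ite_mem,
      union_inter_cancel_left, union_inter_cancel_right]
    exact sub_eq_zero.mpr (congrFun h (Fin.castLE hd j))
  have hw := Matrix.eq_zero_of_forall_pow_sum_mul_pow_eq_zero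
    (hv.comp (Subtype.val_injective.comp e.injective)) hsum
  ext x
  by_cases hx : x ∈ S ∪ T
  · have hwx : w x = 0 := by simpa using congrFun hw (e.symm ⟨x, hx⟩)
    by_cases hxS : x ∈ S <;> by_cases hxT : x ∈ T <;> simp_all [w]
  · grind

end PowerSums

section UpperBound

lemma exists_bicoloring_isDaisyFree {α R : Type*} [Fintype α] [DecidableEq α] [Fintype R]
    [CommRing R] [IsDomain R] {v : α → R} (hv : Function.Injective v) {t : ℕ}
    (ht : Fintype.card R ^ (2 * t) * (Fintype.card α).choose (2 * t) * 2 < 2 ^ t.centralBinom) :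
    ∃ g : Finset α → Bool, ∀ b, IsDaisyFree t {X | g X = b} := by
  classical
  let edge : (Fin (2 * t) → R) × Finset α → Finset (Fin (2 * t) → R) := fun kT =>
    (kT.2.powersetCard t).image fun P => kT.1 + powerSums v (2 * t) P
  let H := (univ ×ˢ (univ : Finset α).powersetCard (2 * t)).image edge
  have hedge : ∀ e ∈ H, t.centralBinom ≤ #e := by
    refine forall_mem_image.mpr fun kT hkT => ?_
    have hT : #kT.2 = 2 * t := (mem_powersetCard.mp (mem_product.mp hkT).2).2
    have hinj : Set.InjOn (fun P => kT.1 + powerSums v (2 * t) P) (kT.2.powersetCard t) := by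
      intro P hP Q hQ hPQ
      have hP := (mem_powersetCard.mp (mem_coe.mp hP)).2
      have hQ := (mem_powersetCard.mp (mem_coe.mp hQ)).2
      exact eq_of_powerSums_eq hv ((card_union_le P Q).trans (by omega)) (add_left_cancel hPQ)
    rw [show #(edge kT) = _ from card_image_of_injOn hinj, card_powersetCard, hT, Nat.centralBinom]
  have hH : #H ≤ Fintype.card R ^ (2 * t) * (Fintype.card α).choose (2 * t) := by
    refine card_image_le.trans_eq ?_
    simp [card_product]
  obtain ⟨g, hg⟩ := exists_coloring_forall_exists_ne (κ := Bool) H hedge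
    (by rw [Fintype.card_bool]; exact (Nat.mul_le_mul_right 2 hH).trans_lt ht)
  refine ⟨fun X => g (powerSums v (2 * t) X), fun b S T hST hT hsub => ?_⟩
  obtain ⟨_, hx, hxb⟩ := hg (edge (powerSums v (2 * t) S, T))
    (mem_image_of_mem edge (by simp [hT])) b
  obtain ⟨P, hP, rfl⟩ := mem_image.mp hx
  refine hxb ?_
  rw [← powerSums_union (disjoint_of_subset_right (mem_powersetCard.mp hP).1 hST)]
  exact hsub (mem_coe.mpr (mem_image_of_mem (S ∪ ·) hP))

lemma exists_bicoloring_isDaisyFree_of_card_le_two_pow {α : Type*} [Fintype α] [DecidableEq α]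
    {l t : ℕ} (hl : l ≠ 0) (hα : Fintype.card α ≤ 2 ^ l) (ht : 4 * t * l + 1 < t.centralBinom) :
    ∃ g : Finset α → Bool, ∀ b, IsDaisyFree t {X | g X = b} := by
  let F := GaloisField 2 l
  have : Fintype F := Fintype.ofFinite F
  have hF : Fintype.card F = 2 ^ l := by rw [← Nat.card_eq_fintype_card, GaloisField.card 2 l hl]
  obtain ⟨v⟩ : Nonempty (α ↪ F) := Function.Embedding.nonempty_of_card_le (hα.trans_eq hF.symm)
  refine exists_bicoloring_isDaisyFree v.injective ?_
  calc Fintype.card F ^ (2 * t) * (Fintype.card α).choose (2 * t) * 2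
      ≤ (2 ^ l) ^ (2 * t) * (2 ^ l) ^ (2 * t) * 2 := by
        rw [hF]
        gcongr
        exact (Nat.choose_le_pow _ _).trans (Nat.pow_le_pow_left hα _)
    _ = 2 ^ (4 * t * l + 1) := by ring
    _ < 2 ^ t.centralBinom := Nat.pow_lt_pow_right one_lt_two ht

lemma mutualVisibilityChromaticNumber_hypercube_le_two_mul {n l t : ℕ} (hl : l ≠ 0)
    (hn : n ≤ 2 ^ l) (ht3 : 3 ≤ t) (ht : 4 * t * l + 1 < t.centralBinom) :
    (hypercube n).mutualVisibilityChromaticNumber ≤ 2 * t := by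
  obtain ⟨g, hg⟩ := exists_bicoloring_isDaisyFree_of_card_le_two_pow (α := Fin n) hl
    (by rwa [Fintype.card_fin]) ht
  have : NeZero t := ⟨by omega⟩
  calc (hypercube n).mutualVisibilityChromaticNumber
      ≤ Fintype.card (Bool × ZMod t) := by
        refine mutualVisibilityChromaticNumber_le_card (fun X => (g X, (#X : ZMod t))) ?_
        rintro ⟨b, r⟩
        have hfree := (hg b).mono (M := {X | (g X, (#X : ZMod t)) = (b, r)})
          fun X hX => (Prod.mk.inj hX).1
        refine hfree.isMutualVisibilitySet ht3 (r := r.val) fun X hX => ?_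
        rw [← ZMod.natCast_eq_natCast_iff, ZMod.natCast_zmod_val]
        exact (Prod.mk.inj hX).2
    _ = 2 * t := by rw [Fintype.card_prod, Fintype.card_bool, ZMod.card]

lemma sq_le_two_pow {t : ℕ} (ht : 4 ≤ t) : t ^ 2 ≤ 2 ^ t := by
  induction t, ht using Nat.le_induction with
  | base => norm_num
  | succ t ht ih => rw [pow_succ 2]; nlinarith

lemma four_mul_mul_add_one_lt_centralBinom {l s : ℕ} (hl : l ≤ 2 ^ s) :
    4 * (s + 4) * l + 1 < (s + 4).centralBinom := by
  set t := s + 4 with ht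
  have hpos : 1 ≤ t * 2 ^ s := Nat.mul_pos (by omega) Nat.one_le_two_pow
  refine lt_of_mul_lt_mul_left (a := t) ?_ (Nat.zero_le t)
  calc t * (4 * t * l + 1) ≤ t * (4 * t * 2 ^ s + t * 2 ^ s) := by
        gcongr
    _ = 5 * 2 ^ s * t ^ 2 := by ring
    _ ≤ 2 ^ 4 * 2 ^ s * 2 ^ t :=
        Nat.mul_le_mul (Nat.mul_le_mul_right _ (by norm_num)) (sq_le_two_pow (by omega))
    _ = 4 ^ t := by rw [← pow_add, add_comm 4 s, ← ht, ← mul_pow]; norm_num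
    _ < t * t.centralBinom := Nat.four_pow_lt_mul_centralBinom t (by omega)

theorem mutualVisibilityChromaticNumber_hypercube_le_log_log (n : ℕ) :
    (hypercube n).mutualVisibilityChromaticNumber ≤ 2 * Nat.log 2 (Nat.log 2 n) + 10 := by
  have hn : n ≤ 2 ^ (Nat.log 2 n + 1) := (Nat.lt_pow_succ_log_self one_lt_two n).le
  have hlog : Nat.log 2 n + 1 ≤ 2 ^ (Nat.log 2 (Nat.log 2 n) + 1) :=
    Nat.lt_pow_succ_log_self one_lt_two (Nat.log 2 n)
  have := mutualVisibilityChromaticNumber_hypercube_le_two_mul (Nat.succ_ne_zero _) hn (by omega)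
    (four_mul_mul_add_one_lt_centralBinom hlog)
  omega

lemma natLog_natLog_le_logb_logb {b n : ℕ} (hb : 1 < b) (hn : b ≤ n) :
    (Nat.log b (Nat.log b n) : ℝ) ≤ Real.logb b (Real.logb b n) := by
  have hpos : 0 < Nat.log b n := Nat.log_pos hb hn
  exact (Real.natLog_le_logb (Nat.log b n) b).trans <| Real.logb_le_logb_of_le
    (by exact_mod_cast hb) (by exact_mod_cast hpos) (Real.natLog_le_logb n b)

theorem isBigO_mutualVisibilityChromaticNumber_hypercube :
    (fun n : ℕ => ((hypercube n).mutualVisibilityChromaticNumber : ℝ)) =O[Filter.atTop]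
      (fun n : ℕ => Real.logb 2 (Real.logb 2 (n : ℝ))) := by
  refine Asymptotics.IsBigO.of_bound 12 ?_
  filter_upwards [Filter.eventually_ge_atTop 4] with n hn
  have hlog : 2 ≤ Nat.log 2 n := Nat.le_log_of_pow_le one_lt_two hn
  have hloglog : (1 : ℝ) ≤ Nat.log 2 (Nat.log 2 n) := by
    exact_mod_cast Nat.log_pos one_lt_two hlog
  have hreal : (Nat.log 2 (Nat.log 2 n) : ℝ) ≤ Real.logb 2 (Real.logb 2 n) := by
    exact_mod_cast natLog_natLog_le_logb_logb one_lt_two (by omega : 2 ≤ n)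
  have hbound : ((hypercube n).mutualVisibilityChromaticNumber : ℝ) ≤
      2 * Nat.log 2 (Nat.log 2 n) + 10 := by
    exact_mod_cast mutualVisibilityChromaticNumber_hypercube_le_log_log n
  rw [Real.norm_of_nonneg (Nat.cast_nonneg _), Real.norm_of_nonneg (by linarith)]
  linarith

end UpperBound

theorem theorem2 :
    Filter.Tendsto (fun n : ℕ => (hypercube n).mutualVisibilityChromaticNumber)
        Filter.atTop Filter.atTop ∧
      (fun n : ℕ => ((hypercube n).mutualVisibilityChromaticNumber : ℝ)) =O[Filter.atTop]
        (fun n : ℕ => Real.logb 2 (Real.logb 2 (n : ℝ))) ∧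
      ¬ ∃ C : ℝ, 0 < C ∧
        ∀ n : ℕ, ((hypercube n).mutualVisibilityChromaticNumber : ℝ) ≤ C := by
  refine ⟨tendsto_mutualVisibilityChromaticNumber_hypercube,
    isBigO_mutualVisibilityChromaticNumber_hypercube, ?_⟩
  rintro ⟨C, -, hC⟩
  have hreal : Filter.Tendsto
      (fun n : ℕ => ((hypercube n).mutualVisibilityChromaticNumber : ℝ)) .atTop .atTop :=
    tendsto_natCast_atTop_atTop.comp tendsto_mutualVisibilityChromaticNumber_hypercube
  obtain ⟨n, hn⟩ := (hreal.eventually_gt_atTop C).exists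
  exact (hC n).not_gt hn
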